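/- Let $G$ be a nice group, that is, a finite group which is either a cyclic $p$-group for some prime $p$, or a generalized quaternion group $Q_{4n}=\langle a,b : a^n=b^2,\ a^{2n}=1,\ b^{-1}ab=a^{-1}\rangle$ with $n\ge 2$ whose order is a power of $2$. For a $G$-space $X$, let the mapping index $\operatorname{ind} X$ be the least $k\ge 0$ for which there is a continuous $G$-equivariant map $X\to E_kG$, where $E_kG=G^{*(k+1)}$ is the $(k+1)$-fold join of the discrete space $G$ with $G$ acting by left translation ($\operatorname{ind}X=\infty$ if there is no such $k$). If $\mathcal K_1,\mathcal K_2$ are free $G$-simplicial complexes (simplicial complexes with a simplicial $G$-action that is free on the geometric realization) with $\operatorname{ind}\mathcal K_1=\operatorname{ind}\mathcal K_2=1$, then $\operatorname{ind}(\mathcal K_1\times\mathcal K_2)=1$, where $\mathcal K_1\times\mathcal K_2$ is the product of the geometric realizations with the diagonal $G$-action. In particular, the statement $\mathsf{HCT}_1(G)$ is true, where $\mathsf{HCT}_n(G)$ says: for all finite free $G$-simplicial complexes $\mathcal K_1,\mathcal K_2$, if $\operatorname{ind}\mathcal K_1=\operatorname{ind}\mathcal K_2=n$, then $\operatorname{ind}(\mathcal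 K_1\times\mathcal K_2)=n$. -/

import Mathlib

universe u v w

noncomputable section

/-- A finite group is *nice* if it is a cyclic `p`-group for some prime `p`, or a generalized
quaternion group `Q_{4n}`, `n ≥ 2`, whose order is a power of `2`. -/
def IsNiceGroup (G : Type u) [Group G] : Prop :=
  Finite G ∧
    ((IsCyclic G ∧ ∃ p : ℕ, p.Prime ∧ IsPGroup p G) ∨
      ((∃ n : ℕ, 2 ≤ n ∧ Nonempty (G ≃* QuaternionGroup n)) ∧ ∃ m : ℕ, Nat.card G = 2 ^ m))

/-- A `G`-simplicial complex with vertex set `V`: an abstract simplicial complex together with an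
action of `G` on the vertices that sends faces to faces. -/
structure GSimplicialComplex (G : Type u) [Group G] (V : Type v) [MulAction G V] extends
    AbstractSimplicialComplex V where
  smul_mem : ∀ (g : G) (s : Finset V), s ∈ faces → s.map (MulAction.toPerm g).toEmbedding ∈ faces

namespace GSimplicialComplex

section Realization

variable {G : Type u} [Group G] {V : Type v} [MulAction G V]

/-- The geometric realization, in barycentric coordinates: nonnegative weights on the vertices
which vanish outside some face and have total sum `1`. -/
@[ext]
structure Realization (K : GSimplicialComplex G V) where
  weight : V → ℝ
  nonneg : ∀ v, 0 ≤ weight v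
  exists_face : ∃ s ∈ K.faces, (∀ v, v ∉ s → weight v = 0) ∧ ∑ v ∈ s, weight v = 1

variable (K : GSimplicialComplex G V)

open Classical in
/-- The inclusion of the closed simplex spanned by a face `s` into the realization
(extension of the barycentric coordinates by zero). -/
def simplexMap (s : K.faces) (t : stdSimplex ℝ (s : Finset V)) : K.Realization where
  weight v := if h : v ∈ (s : Finset V) then t.1 ⟨v, h⟩ else 0
  nonneg v := by
    split_ifs with h
    · exact t.2.1 _
    · exact le_rfl
  exists_face := by
    refine ⟨s, s.2, fun v hv => dif_neg hv, ?_⟩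
    rw [← Finset.sum_coe_sort]
    simpa using t.2.2

/-- The usual (weak, or coherent) topology of the realization: a set is open if and only if its
trace on every closed simplex is open. For a finite complex this is the topology
induced from `ℝ^V`. -/
instance : TopologicalSpace K.Realization :=
  ⨆ s : K.faces, TopologicalSpace.coinduced (K.simplexMap s) inferInstance

/-- The action of `G` on the realization that extends the action on the vertices linearly over
each simplex: the weight of `v` in `x` becomes the weight of `g • v` in `g • x`. -/
instance : MulAction G K.Realization where
  smul g x :=
    { weight := fun v => x.weight (g⁻¹ • v)
      nonneg := fun v => x.nonneg _
      exists_face := by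
        obtain ⟨s, hs, h0, h1⟩ := x.exists_face
        refine ⟨_, K.smul_mem g s hs, fun v hv => h0 _ fun h => hv ?_, ?_⟩
        · exact Finset.mem_map.2 ⟨g⁻¹ • v, h, by simp⟩
        · simpa using h1 }
  one_smul x := by
    apply Realization.ext
    funext v
    change x.weight ((1 : G)⁻¹ • v) = x.weight v
    simp
  mul_smul g h x := by
    apply Realization.ext
    funext v
    change x.weight ((g * h)⁻¹ • v) = x.weight (h⁻¹ • g⁻¹ • v)
    rw [mul_inv_rev, mul_smul]

/-- A `G`-simplicial complex is free if `G` acts freely on its geometric realization. -/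
def IsFree : Prop :=
  ∀ (g : G) (x : K.Realization), g • x = x → g = 1

end Realization

end GSimplicialComplex

/-- The vertices of the `(k+1)`-fold join of `G`: `k + 1` disjoint copies of `G`. -/
@[ext]
structure JoinVertex (G : Type u) (k : ℕ) where
  elt : G
  level : Fin (k + 1)

/-- `G` acts on each of its copies by left translation. -/
instance (G : Type u) [Group G] (k : ℕ) : MulAction G (JoinVertex G k) where
  smul g x := ⟨g * x.elt, x.level⟩
  one_smul x := JoinVertex.ext (one_mul x.elt) rfl
  mul_smul g h x := JoinVertex.ext (mul_assoc g h x.elt) rfl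

/-- The `(k+1)`-fold join `G^{*(k+1)}` of the discrete `G`-space `G`, as a simplicial complex: the
faces are the nonempty finite sets of vertices with at most one vertex in each copy of `G`. -/
def joinComplex (G : Type u) [Group G] (k : ℕ) : GSimplicialComplex G (JoinVertex G k) where
  faces := {s | s.Nonempty ∧ ∀ x ∈ s, ∀ y ∈ s, x.level = y.level → x = y}
  isRelLowerSet_faces := fun _ hs =>
    ⟨hs.1, fun _ hts ht => ⟨ht, fun x hx y hy => hs.2 x (hts hx) y (hts hy)⟩⟩
  singleton_mem x := by
    refine ⟨Finset.singleton_nonempty x, fun y hy z hz _ => ?_⟩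
    rw [Finset.mem_singleton.1 hy, Finset.mem_singleton.1 hz]
  smul_mem g s hs := by
    refine ⟨hs.1.map, fun x hx y hy hxy => ?_⟩
    obtain ⟨x', hx', rfl⟩ := Finset.mem_map.1 hx
    obtain ⟨y', hy', rfl⟩ := Finset.mem_map.1 hy
    rw [hs.2 x' hx' y' hy' hxy]

/-- The space `E_k G = G^{*(k+1)}`. -/
abbrev EG (G : Type u) [Group G] (k : ℕ) : Type u := (joinComplex G k).Realization

/-- The mapping index of a `G`-space `X`: the least `k` for which there is a continuous
`G`-equivariant map `X → E_k G` (and `⊤` if there is no such `k`). -/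
def mappingIndex (G : Type u) [Group G] (X : Type v) [TopologicalSpace X] [MulAction G X] : ℕ∞ :=
  sInf {n : ℕ∞ | ∃ k : ℕ, n = k ∧ ∃ f : X →[G] EG G k, Continuous f}

/-- The statement `HCT_n(G)`. The product of two realizations carries the product
topology and the diagonal action. -/
def HCT (G : Type u) [Group G] (n : ℕ) : Prop :=
  ∀ (V₁ : Type v) (V₂ : Type w) [Finite V₁] [Finite V₂] [MulAction G V₁] [MulAction G V₂]
    (K₁ : GSimplicialComplex G V₁) (K₂ : GSimplicialComplex G V₂),
    K₁.IsFree → K₂.IsFree →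
    mappingIndex G K₁.Realization = n → mappingIndex G K₂.Realization = n →
    mappingIndex G (K₁.Realization × K₂.Realization) = n

end

/-! ### Nice groups have a smallest nontrivial subgroup -/

theorem IsCyclic.mem_zpowers_of_orderOf_eq {G : Type u} [Group G] [Finite G] [IsCyclic G]
    {x y : G} (h : orderOf x = orderOf y) : y ∈ Subgroup.zpowers x := by
  classical
  have := Fintype.ofFinite G
  have hsub : (Finset.univ.filter fun z : G => z ∈ Subgroup.zpowers x) ⊆
      Finset.univ.filter fun z : G => z ^ orderOf x = 1 := by
    intro z hz
    obtain ⟨k, rfl⟩ := Subgroup.mem_zpowers_iff.1 (Finset.mem_filter.1 hz).2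
    refine Finset.mem_filter.2 ⟨Finset.mem_univ _, ?_⟩
    rw [← zpow_natCast, zpow_comm, zpow_natCast, pow_orderOf_eq_one, one_zpow]
  have hcard : (Finset.univ.filter fun z : G => z ∈ Subgroup.zpowers x).card = orderOf x := by
    rw [← Nat.card_zpowers, ← Fintype.card_subtype, Nat.card_eq_fintype_card]
  have heq := Finset.eq_of_subset_of_card_le hsub
    ((IsCyclic.card_pow_eq_one_le (orderOf_pos x)).trans hcard.ge)
  have hy : y ∈ Finset.univ.filter fun z : G => z ^ orderOf x = 1 :=
    Finset.mem_filter.2 ⟨Finset.mem_univ _, by rw [h, pow_orderOf_eq_one]⟩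
  rw [← heq] at hy
  exact (Finset.mem_filter.1 hy).2

theorem QuaternionGroup.eq_a_of_orderOf_eq_two {n : ℕ} (hn : n ≠ 0) {x : QuaternionGroup n}
    (hx : orderOf x = 2) : x = QuaternionGroup.a n := by
  have : NeZero n := ⟨hn⟩
  cases x with
  | xa i => rw [QuaternionGroup.orderOf_xa] at hx; omega
  | a i =>
    have h1 : QuaternionGroup.a i ≠ 1 := by
      intro h
      rw [h, orderOf_one] at hx
      omega
    have h2 : QuaternionGroup.a (i + i) = 1 := by
      rw [← QuaternionGroup.a_mul_a, ← sq, ← hx, pow_orderOf_eq_one]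
    rw [QuaternionGroup.one_def] at h1 h2
    have hi0 : i ≠ 0 := fun h => h1 (by rw [h])
    have hii : i + i = 0 := QuaternionGroup.a.inj h2
    congr 1
    have hcast : ((i.val + i.val : ℕ) : ZMod (2 * n)) = 0 := by
      push_cast
      rw [ZMod.natCast_rightInverse i, hii]
    obtain ⟨c, hc⟩ := (ZMod.natCast_eq_zero_iff _ _).1 hcast
    have hlt := ZMod.val_lt i
    have hpos : i.val ≠ 0 := fun h => hi0 ((ZMod.val_eq_zero i).1 h)
    have hval : i.val = n := by
      have hc1 : c = 1 := by
        have : c < 2 := by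
          by_contra! h
          have := Nat.mul_le_mul_left (2 * n) h
          omega
        have : c ≠ 0 := by
          rintro rfl
          omega
        omega
      rw [hc1] at hc
      omega
    exact (ZMod.natCast_rightInverse i).symm.trans (congrArg _ hval)

theorem IsNiceGroup.exists_prime_mem_zpowers {G : Type u} [Group G] (hG : IsNiceGroup G) :
    ∃ p : ℕ, p.Prime ∧ IsPGroup p G ∧
      ∀ x y : G, orderOf x = p → orderOf y = p → y ∈ Subgroup.zpowers x := by
  obtain ⟨hfin, ⟨hcyc, p, hp, hpG⟩ | ⟨⟨n, hn, ⟨e⟩⟩, m, hm⟩⟩ := hG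
  · exact ⟨p, hp, hpG, fun x y hx hy => IsCyclic.mem_zpowers_of_orderOf_eq (hx.trans hy.symm)⟩
  · refine ⟨2, Nat.prime_two, IsPGroup.of_card hm, fun x y hx hy => ?_⟩
    have key : ∀ z : G, orderOf z = 2 → e z = QuaternionGroup.a n := fun z hz =>
      QuaternionGroup.eq_a_of_orderOf_eq_two (by omega) (by rw [MulEquiv.orderOf_eq, hz])
    rw [e.injective ((key y hy).trans (key x hx).symm)]
    exact Subgroup.mem_zpowers x

theorem IsPGroup.exists_mem_orderOf_eq {G : Type u} [Group G] {p : ℕ} (hp : p.Prime)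
    (hG : IsPGroup p G) {H : Subgroup G} (hH : H ≠ ⊥) : ∃ x ∈ H, orderOf x = p := by
  have : Fact p.Prime := ⟨hp⟩
  obtain ⟨g, hgH, hg⟩ := H.bot_or_exists_ne_one.resolve_left hH
  have hpos : orderOf g ≠ 0 := (hG.isOfFinOrder hp.ne_zero g).orderOf_pos.ne'
  exact ⟨g ^ (orderOf g / p), H.pow_mem hgH _,
    orderOf_pow_orderOf_div hpos (hG.dvd_orderOf hg)⟩

theorem IsNiceGroup.inf_ne_bot {G : Type u} [Group G] (hG : IsNiceGroup G) {H₁ H₂ : Subgroup G}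
    (h₁ : H₁ ≠ ⊥) (h₂ : H₂ ≠ ⊥) : H₁ ⊓ H₂ ≠ ⊥ := by
  obtain ⟨p, hp, hpG, huniq⟩ := hG.exists_prime_mem_zpowers
  obtain ⟨x, hx, hxp⟩ := hpG.exists_mem_orderOf_eq hp h₁
  obtain ⟨y, hy, hyp⟩ := hpG.exists_mem_orderOf_eq hp h₂
  intro h
  have hmem : y ∈ H₁ ⊓ H₂ :=
    ⟨(Subgroup.zpowers_le.2 hx) (huniq x y hxp hyp), hy⟩
  rw [h, Subgroup.mem_bot] at hmem
  rw [hmem, orderOf_one] at hyp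
  exact hp.one_lt.ne hyp

/-! ### The action on connected components -/

theorem MulAction.exists_hom_of_stabilizer_eq_bot {G : Type u} [Group G] {X : Type v}
    [MulAction G X] (h : ∀ x : X, MulAction.stabilizer G x = ⊥) : Nonempty (X →[G] G) := by
  let rep : X → X := fun x => (Quotient.mk (MulAction.orbitRel G X) x).out
  have hrep : ∀ x, ∃ g : G, g • rep x = x := fun x =>
    (MulAction.orbitRel G X).symm (Quotient.mk_out (s := MulAction.orbitRel G X) x)
  have hsmul : ∀ (g : G) (x : X), rep (g • x) = rep x := fun g x =>
    congrArg Quotient.out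
      (Quotient.sound (s := MulAction.orbitRel G X) (MulAction.mem_orbit x g))
  choose f hf using hrep
  refine ⟨⟨f, fun g x => ?_⟩⟩
  have hmem : (g * f x)⁻¹ * f (g • x) ∈ MulAction.stabilizer G (rep x) := by
    have h1 := hf (g • x)
    rw [hsmul] at h1
    rw [MulAction.mem_stabilizer_iff, mul_smul, h1, inv_smul_eq_iff, mul_smul, hf]
  rw [h, Subgroup.mem_bot, inv_mul_eq_one] at hmem
  exact hmem.symm

section Components

variable {G : Type u} [Group G] {X : Type v} [TopologicalSpace X] [MulAction G X]
  [ContinuousConstSMul G X]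

/-- A group that acts by homeomorphisms permutes the connected components. -/
instance ConnectedComponents.mulAction : MulAction G (ConnectedComponents X) where
  smul g := (continuous_const_smul g : Continuous fun x : X => g • x).connectedComponentsMap
  one_smul c := by
    obtain ⟨x, rfl⟩ := ConnectedComponents.surjective_coe c
    exact congrArg _ (one_smul G x)
  mul_smul g h c := by
    obtain ⟨x, rfl⟩ := ConnectedComponents.surjective_coe c
    exact congrArg _ (mul_smul g h x)

theorem ConnectedComponents.smul_coe (g : G) (x : X) :
    g • (x : ConnectedComponents X) = ((g • x : X) : ConnectedComponents X) :=
  rfl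

end Components

/-! ### Realizations -/

namespace GSimplicialComplex

variable {G : Type u} [Group G] {V : Type v} [MulAction G V] (K : GSimplicialComplex G V)

theorem continuous_simplexMap (s : K.faces) : Continuous (K.simplexMap s) :=
  continuous_iff_coinduced_le.2
    (le_iSup (fun s : K.faces => TopologicalSpace.coinduced (K.simplexMap s) inferInstance) s)

variable {K}

theorem continuous_iff_simplexMap {Y : Type w} [TopologicalSpace Y] {f : K.Realization → Y} :
    Continuous f ↔ ∀ s : K.faces, Continuous (f ∘ K.simplexMap s) := by
  refine continuous_iSup_dom.trans (forall_congr' fun s => ?_)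
  exact continuous_coinduced_dom

theorem face_nonempty (s : K.faces) : (s : Finset V).Nonempty :=
  (K.isRelLowerSet_faces s.2).1

theorem coe_simplexMap_eq (s : K.faces) (t t' : stdSimplex ℝ (s : Finset V)) :
    (K.simplexMap s t : ConnectedComponents K.Realization) = K.simplexMap s t' := by
  have : Nonempty (s : Finset V) := (face_nonempty s).to_subtype
  rw [ConnectedComponents.coe_eq_coe']
  exact (isPreconnected_range (K.continuous_simplexMap s)).subset_connectedComponent
    (Set.mem_range_self t') (Set.mem_range_self t)

/-- A function on the realization that factors through the connected components is continuous. -/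
theorem continuous_comp_coe {Y : Type w} [TopologicalSpace Y]
    (f : ConnectedComponents K.Realization → Y) :
    Continuous fun x : K.Realization => f x :=
  continuous_iff_simplexMap.2 fun s =>
    continuous_of_const fun t t' => congrArg f (coe_simplexMap_eq s t t')

theorem smul_weight (g : G) (x : K.Realization) (v : V) :
    (g • x).weight v = x.weight (g⁻¹ • v) :=
  rfl

instance : ContinuousConstSMul G K.Realization where
  continuous_const_smul g := by
    refine continuous_iff_simplexMap.2 fun s => ?_
    let s' : K.faces := ⟨_, K.smul_mem g s s.2⟩
    have hs' : ∀ v, v ∈ (s' : Finset V) ↔ g⁻¹ • v ∈ (s : Finset V) := by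
      intro v
      refine Finset.mem_map.trans ⟨?_, fun h => ⟨_, h, by simp⟩⟩
      rintro ⟨w, hw, rfl⟩
      simpa using hw
    let e : (s' : Finset V) ≃ (s : Finset V) :=
      (MulAction.toPerm g⁻¹).subtypeEquiv hs'
    let τ : stdSimplex ℝ (s : Finset V) → stdSimplex ℝ (s' : Finset V) := fun t =>
      ⟨fun v => t.1 (e v), fun v => t.2.1 _, (e.sum_comp t.1).trans t.2.2⟩
    have hτ : Continuous τ := by
      refine Continuous.subtype_mk (continuous_pi fun v => ?_) _
      exact (continuous_apply (e v)).comp continuous_subtype_val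
    have hcomp : (fun x : K.Realization => g • x) ∘ K.simplexMap s = K.simplexMap s' ∘ τ := by
      funext t
      apply Realization.ext
      funext v
      by_cases hv : v ∈ (s' : Finset V)
      · have hv' := (hs' v).1 hv
        simp [simplexMap, smul_weight, hv, hv', τ, e, Equiv.subtypeEquiv]
      · have hv' : g⁻¹ • v ∉ (s : Finset V) := fun h => hv ((hs' v).2 h)
        simp [simplexMap, smul_weight, hv, hv']
    rw [hcomp]
    exact (K.continuous_simplexMap s').comp hτ

end GSimplicialComplex

open GSimplicialComplex

instance EG.discreteTopology_zero (G : Type u) [Group G] : DiscreteTopology (EG G 0) := by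
  refine discreteTopology_iff_forall_isOpen.2 fun U => ?_
  refine isOpen_iSup_iff.2 fun s => isOpen_coinduced.2 ?_
  have hs : Subsingleton ((s : Finset (JoinVertex G 0)) : Type u) :=
    ⟨fun x y => Subtype.ext (s.2.2 x x.2 y y.2 (Subsingleton.elim (α := Fin 1) _ _))⟩
  have := Subsingleton.discreteTopology (α := stdSimplex ℝ (s : Finset (JoinVertex G 0)))
  exact isOpen_discrete _

open Classical in
/-- The vertex of `E_0 G` given by an element of `G`. -/
noncomputable def EG.vertex (G : Type u) [Group G] : G →[G] EG G 0 where
  toFun g :=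
    { weight := Pi.single ⟨g, 0⟩ 1
      nonneg := fun v => (Pi.single_nonneg.2 zero_le_one : (0 : JoinVertex G 0 → ℝ) ≤ _) v
      exists_face := ⟨{⟨g, 0⟩}, (joinComplex G 0).singleton_mem _,
        fun v hv => Pi.single_eq_of_ne (by simpa using hv) _, by simp⟩ }
  map_smul' g h := by
    apply Realization.ext
    funext v
    rw [smul_weight]
    simp only [Pi.single_apply, inv_smul_eq_iff]
    rfl

theorem EG.smul_eq_self {G : Type u} [Group G] {g : G} {x : EG G 0} (h : g • x = x) : g = 1 := by
  obtain ⟨s, hs, h0, h1⟩ := x.exists_face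
  obtain ⟨v, hv, hne⟩ : ∃ v ∈ s, x.weight v ≠ 0 := by
    by_contra! hcon
    rw [Finset.sum_eq_zero hcon] at h1
    exact zero_ne_one h1
  have hg : x.weight (g⁻¹ • v) ≠ 0 := by
    rwa [← smul_weight, h]
  have hmem : g⁻¹ • v ∈ s := by
    by_contra hcon
    exact hg (h0 _ hcon)
  have heq : g⁻¹ • v = v := hs.2 _ hmem _ hv (Subsingleton.elim (α := Fin 1) _ _)
  exact inv_eq_one.1 (mul_eq_right.1 (congrArg JoinVertex.elt heq))

/-! ### The mapping index -/

theorem mappingIndex_le_iff {G : Type u} [Group G] {X : Type v} [TopologicalSpace X]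
    [MulAction G X] {k : ℕ} :
    mappingIndex G X ≤ k ↔ ∃ j ≤ k, ∃ f : X →[G] EG G j, Continuous f := by
  constructor
  · intro h
    have hne : {n : ℕ∞ | ∃ k : ℕ, n = k ∧ ∃ f : X →[G] EG G k, Continuous f}.Nonempty := by
      by_contra hcon
      rw [Set.not_nonempty_iff_eq_empty] at hcon
      rw [mappingIndex, hcon, sInf_empty, top_le_iff] at h
      exact ENat.natCast_ne_top k h
    obtain ⟨j, hj, hf⟩ := csInf_mem hne
    exact ⟨j, by rw [mappingIndex, hj] at h; exact_mod_cast h, hf⟩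
  · rintro ⟨j, hj, hf⟩
    have hle : mappingIndex G X ≤ j := sInf_le ⟨j, rfl, hf⟩
    exact hle.trans (Nat.cast_le.2 hj)

theorem mappingIndex_eq_zero_iff {G : Type u} [Group G] {X : Type v} [TopologicalSpace X]
    [MulAction G X] : mappingIndex G X = 0 ↔ ∃ f : X →[G] EG G 0, Continuous f := by
  rw [← nonpos_iff_eq_zero, ← Nat.cast_zero, mappingIndex_le_iff]
  constructor
  · rintro ⟨j, hj, hf⟩
    obtain rfl := Nat.le_zero.1 hj
    exact hf
  · exact fun hf => ⟨0, le_rfl, hf⟩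

theorem mappingIndex_mono {G : Type u} [Group G] {X : Type v} {Y : Type w} [TopologicalSpace X]
    [TopologicalSpace Y] [MulAction G X] [MulAction G Y] (f : X →[G] Y) (hf : Continuous f) :
    mappingIndex G X ≤ mappingIndex G Y := by
  refine le_sInf ?_
  rintro _ ⟨k, rfl, h, hh⟩
  exact sInf_le ⟨k, rfl, h.comp f, hh.comp hf⟩

theorem GSimplicialComplex.exists_stabilizer_ne_bot {G : Type u} [Group G] {V : Type v}
    [MulAction G V] {K : GSimplicialComplex G V} (h : mappingIndex G K.Realization ≠ 0) :
    ∃ x : K.Realization,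
      MulAction.stabilizer G (x : ConnectedComponents K.Realization) ≠ ⊥ := by
  by_contra! hcon
  obtain ⟨f⟩ := MulAction.exists_hom_of_stabilizer_eq_bot
    (ConnectedComponents.surjective_coe.forall.2 hcon)
  refine h (mappingIndex_eq_zero_iff.2 ⟨⟨fun x => EG.vertex G (f x), fun g x => ?_⟩,
    continuous_comp_coe fun c => EG.vertex G (f c)⟩)
  rw [← ConnectedComponents.smul_coe, map_smul, map_smul]
  rfl

theorem mappingIndex_prod_ne_zero {G : Type u} [Group G] {X : Type v} {Y : Type w}
    [TopologicalSpace X] [TopologicalSpace Y] [MulAction G X] [MulAction G Y]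
    [ContinuousConstSMul G X] [ContinuousConstSMul G Y] {x : X} {y : Y}
    (h : MulAction.stabilizer G (x : ConnectedComponents X) ⊓
      MulAction.stabilizer G (y : ConnectedComponents Y) ≠ ⊥) :
    mappingIndex G (X × Y) ≠ 0 := by
  intro h0
  obtain ⟨f, hf⟩ := mappingIndex_eq_zero_iff.1 h0
  obtain ⟨g, ⟨hgx, hgy⟩, hg⟩ := (Subgroup.bot_or_exists_ne_one _).resolve_left h
  have hx : g • x ∈ connectedComponent x := ConnectedComponents.coe_eq_coe'.1 hgx
  have hy : g • y ∈ connectedComponent y := ConnectedComponents.coe_eq_coe'.1 hgy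
  have hconst : f (g • (x, y)) = f (x, y) :=
    (isPreconnected_connectedComponent.prod isPreconnected_connectedComponent).constant
      hf.continuousOn (Set.mk_mem_prod hx hy)
      (Set.mk_mem_prod mem_connectedComponent mem_connectedComponent)
  rw [map_smul] at hconst
  exact hg (EG.smul_eq_self hconst)

theorem IsNiceGroup.mappingIndex_prod_eq_one {G : Type u} [Group G] (hG : IsNiceGroup G)
    {V₁ : Type v} {V₂ : Type w} [MulAction G V₁] [MulAction G V₂]
    {K₁ : GSimplicialComplex G V₁} {K₂ : GSimplicialComplex G V₂}
    (h₁ : mappingIndex G K₁.Realization = 1) (h₂ : mappingIndex G K₂.Realization = 1) :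
    mappingIndex G (K₁.Realization × K₂.Realization) = 1 := by
  refine le_antisymm ?_ (Order.one_le_iff_pos.2 (pos_iff_ne_zero.2 ?_))
  · rw [← h₁]
    exact mappingIndex_mono ⟨Prod.fst, fun _ _ => rfl⟩ continuous_fst
  · obtain ⟨x, hx⟩ := exists_stabilizer_ne_bot (h₁.trans_ne one_ne_zero)
    obtain ⟨y, hy⟩ := exists_stabilizer_ne_bot (h₂.trans_ne one_ne_zero)
    exact mappingIndex_prod_ne_zero (hG.inf_ne_bot hx hy)

theorem theorem2 {G : Type u} [Group G] (hG : IsNiceGroup G) :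
    (∀ (V₁ : Type v) (V₂ : Type w) [MulAction G V₁] [MulAction G V₂]
      (K₁ : GSimplicialComplex G V₁) (K₂ : GSimplicialComplex G V₂),
      K₁.IsFree → K₂.IsFree →
      mappingIndex G K₁.Realization = 1 → mappingIndex G K₂.Realization = 1 →
      mappingIndex G (K₁.Realization × K₂.Realization) = 1) ∧
    HCT.{u, v, w} G 1 := by
  refine ⟨fun V₁ V₂ _ _ K₁ K₂ _ _ h₁ h₂ => hG.mappingIndex_prod_eq_one h₁ h₂, ?_⟩
  intro V₁ V₂ _ _ _ _ K₁ K₂ _ _ h₁ h₂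
  exact_mod_cast hG.mappingIndex_prod_eq_one (by exact_mod_cast h₁) (by exact_mod_cast h₂)
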